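/- Let $K$ be a totally real number field with ring of integers $\mathcal O_K$ and different $\mathcal D_K$ (over $\mathbb Q$). An ideal lattice over $K$ is a pair $(I,\alpha)$, where $I$ is a (nonzero) fractional $\mathcal O_K$-ideal and $\alpha\in K^\times$ is totally positive, equipped with the bilinear form $b_\alpha(x,y)=\mathrm{Tr}_{K/\mathbb Q}(\alpha xy)$ on $I$; its dual is $(I^*,\alpha)$ with $I^*=\alpha^{-1}\mathcal D_K^{-1}I^{-1}$. For a positive integer $\ell$, the ideal lattice $(I,\alpha)$ is called Arakelov-modular of level $\ell$ if there is $\beta\in K^\times$ with $I=\beta I^*$ and $\ell=\beta^2$. Proposition. Let $p$ be an odd prime, $r\ge 1$ an integer, $\zeta_{p^r}=e^{2\pi i/p^r}$, and let $K=\mathbb Q(\zeta_{p^r}+\zeta_{p^r}^{-1})$, which is totally real. Let $\ell$ be a square-free positive integer. 1. If $p\equiv 1\pmod 4$, then there exists an Arakelov-modular lattice of level $\ell$ over $K$ if and only if $\ell\in\{1,p\}$. 2. If $p\equiv 3\pmod 4$, then there exists an Arakelov-modular lattice of level $\ell$ over $K$ if and only if $\ell=1$. Moreover, the lattices can be chosen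 with the following twists. With $\alpha=\left(2-2\cos\frac{2\pi}{p^r}\right)^{-1}$, there is an Arakelov-modular lattice $(I,\alpha)$ over $K$ of level $1$ if $p\equiv 1\pmod 4$, and of level $p$ if $p\equiv 1\pmod 8$. With $\alpha=1$, there is an Arakelov-modular lattice $(I,\alpha)$ over $K$ of level $p$ if $p\equiv 5\pmod 8$, and of level $1$ if $p\equiv 3\pmod 4$. -/

import Mathlib

open NumberField nonZeroDivisors

noncomputable section

/-- An ideal lattice over a totally real number field `K` (complex conjugation on `K` is the
identity): a (nonzero) fractional ideal `I` of `𝓞 K` together with a totally positive twist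
`α ∈ K`, i.e. one whose image is positive under every (automatically real) embedding of `K`. -/
structure IdealLattice (K : Type*) [Field K] [NumberField K] [IsTotallyReal K] where
  I : FractionalIdeal (𝓞 K)⁰ K
  I_ne_zero : I ≠ 0
  α : K
  α_ne_zero : α ≠ 0
  α_totallyPositive : ∀ σ : K →+* ℝ, 0 < σ α

namespace IdealLattice

variable {K : Type*} [Field K] [NumberField K] [IsTotallyReal K]

/-- The bilinear form `b_α(x, y) = Tr_{K/ℚ}(α x y)`; the lattice is its restriction to `I`. -/
def form (L : IdealLattice K) (x y : K) : ℚ :=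
  Algebra.trace ℚ K (L.α * x * y)

/-- The dual lattice `I^* = α⁻¹ 𝓓_K⁻¹ I⁻¹`, where `𝓓_K` is the different of `K/ℚ`. -/
def dual (L : IdealLattice K) : FractionalIdeal (𝓞 K)⁰ K :=
  FractionalIdeal.spanSingleton (𝓞 K)⁰ L.α⁻¹ *
    (differentIdeal ℤ (𝓞 K) : FractionalIdeal (𝓞 K)⁰ K)⁻¹ * L.I⁻¹

/-- `I^*` is the dual of `I` with respect to the form `b_α`. -/
theorem mem_dual (L : IdealLattice K) (x : K) :
    x ∈ L.dual ↔ ∀ y ∈ L.I, ∃ n : ℤ, L.form x y = n := by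
  have h1 : L.dual = FractionalIdeal.spanSingleton (𝓞 K)⁰ L.α⁻¹ *
      FractionalIdeal.dual ℤ ℚ L.I := by
    rw [dual, coeIdeal_differentIdeal ℤ ℚ K (𝓞 K), inv_inv, mul_assoc,
      ← FractionalIdeal.dual_eq_mul_inv]
  rw [h1, FractionalIdeal.mem_singleton_mul]
  constructor
  · rintro ⟨z, hz, rfl⟩ y hy
    obtain ⟨n, hn⟩ := (FractionalIdeal.mem_dual L.I_ne_zero).1 hz y hy
    refine ⟨n, ?_⟩
    rw [form, mul_inv_cancel_left₀ L.α_ne_zero]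
    simpa using hn.symm
  · intro h
    refine ⟨L.α * x, (FractionalIdeal.mem_dual L.I_ne_zero).2 fun y hy => ?_,
      (inv_mul_cancel_left₀ L.α_ne_zero x).symm⟩
    obtain ⟨n, hn⟩ := h y hy
    exact ⟨n, by simpa [form] using hn.symm⟩

/-- `(I, b_α)` is Arakelov-modular of level `ℓ`: there is `β ∈ K^×` with `I = β I^*` and
`ℓ = β β̄`, where `β̄ = β` since `K` is totally real. -/
def IsArakelovModular (L : IdealLattice K) (ℓ : ℕ) : Prop :=
  ∃ β : K, β ≠ 0 ∧ L.I = FractionalIdeal.spanSingleton (𝓞 K)⁰ β * L.dual ∧ (ℓ : K) = β * β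

end IdealLattice

/-- The primitive `n`-th root of unity `ζ_n = exp(2πi/n)`. -/
def zetaRoot (n : ℕ) : ℂ := Complex.exp (2 * Real.pi * Complex.I / n)

/-- The maximal real subfield `ℚ(ζ_n + ζ_n⁻¹)` of the `n`-th cyclotomic field. -/
abbrev RealCyclotomic (n : ℕ) : IntermediateField ℚ ℂ :=
  IntermediateField.adjoin ℚ {zetaRoot n + (zetaRoot n)⁻¹}

theorem zetaRoot_isPrimitiveRoot (n : ℕ) [NeZero n] : IsPrimitiveRoot (zetaRoot n) n :=
  Complex.isPrimitiveRoot_exp n (NeZero.ne n)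

theorem zetaRoot_isIntegral (n : ℕ) [NeZero n] : IsIntegral ℚ (zetaRoot n) :=
  ((zetaRoot_isPrimitiveRoot n).isIntegral (Nat.pos_of_ne_zero (NeZero.ne n))).tower_top

instance RealCyclotomic.numberField (n : ℕ) [NeZero n] : NumberField (RealCyclotomic n) where
  to_charZero := inferInstance
  to_finiteDimensional :=
    IntermediateField.adjoin.finiteDimensional
      ((zetaRoot_isIntegral n).add (zetaRoot_isIntegral n).inv)

/-- `ℚ(ζ_n + ζ_n⁻¹)` is totally real. -/
instance RealCyclotomic.isTotallyReal (n : ℕ) [NeZero n] : IsTotallyReal (RealCyclotomic n) where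
  isReal v := by
    rw [InfinitePlace.isReal_iff, ComplexEmbedding.isReal_iff]
    let M := IntermediateField.adjoin (RealCyclotomic n) {zetaRoot n}
    have : Algebra.IsAlgebraic (RealCyclotomic n) M :=
      IntermediateField.isAlgebraic_adjoin_simple ((zetaRoot_isIntegral n).tower_top)
    let ψ : M →+* ℂ := ComplexEmbedding.lift M v.embedding
    let z : M := ⟨zetaRoot n, IntermediateField.mem_adjoin_simple_self _ _⟩
    let g : RealCyclotomic n :=
      ⟨zetaRoot n + (zetaRoot n)⁻¹, IntermediateField.mem_adjoin_simple_self _ _⟩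
    have hz : z ^ n = 1 := Subtype.ext (zetaRoot_isPrimitiveRoot n).pow_eq_one
    have hψ : ψ z ^ n = 1 := by rw [← map_pow, hz, map_one]
    have hconj : (starRingEnd ℂ) (ψ z) = (ψ z)⁻¹ :=
      (Complex.inv_eq_conj (Complex.norm_eq_one_of_pow_eq_one hψ (NeZero.ne n))).symm
    have hg : v.embedding g = ψ z + (ψ z)⁻¹ := by
      rw [← map_inv₀, ← map_add, ← ComplexEmbedding.lift_algebraMap_apply M v.embedding g]
      rfl
    have key : (ComplexEmbedding.conjugate v.embedding).toRatAlgHom =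
        v.embedding.toRatAlgHom := by
      refine IntermediateField.algHom_ext_of_eq_adjoin _ rfl ?_
      rintro x rfl
      change (starRingEnd ℂ) (v.embedding g) = v.embedding g
      rw [hg, map_add, map_inv₀, hconj, inv_inv, add_comm]
    ext x
    exact congrArg (fun f => f x) key

end

/-!
Write `n = p ^ r`, `K = ℚ(ζ_n + ζ_n⁻¹)` and `M = ℚ(ζ_n)`, a quadratic extension of `K`. The equation
`I = β I^*` says `I² = β α⁻¹ 𝓓_K⁻¹`, so a lattice with given `α` and `β` exists as soon as the ideal
on the right is a square.

*Existence.* The prime `p` is totally ramified in `K`, and the prime above it is generated by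
`2 - ζ_n - ζ_n⁻¹`, which is totally positive and equals `(1 - ζ_n)(1 - ζ_n⁻¹)`
(`prime_span_two_sub`, `span_natCast_eq_pow`, `two_sub_gen_totallyPositive`). The ring of integers of
`M` is `𝓞 K[ζ_n]`, so the different of `M / K` is generated by `ζ_n - ζ_n⁻¹` and has norm `p`. By the
discriminant formula in the tower `M / K / ℚ` the discriminant of `K` is, up to sign, `p ^ e` with
`2 e + 1 = p ^ (r - 1) ((p - 1) r - 1)`, and the different of `K` is the `e`-th power of the prime
above `p` (`differentIdeal_int_eq_pow`). If `p ≡ 1 mod 4`, then `K` contains `√p`, the quadratic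
Gauss sum, which generates the power of that prime with exponent `p ^ (r - 1) (p - 1) / 4`
(`exists_sq_eq_prime`). Taking for `α` either `1` or `(2 - ζ_n - ζ_n⁻¹)⁻¹` and for `β` either `1` or
`√p`, every ideal in sight is a power of one prime, and what remains is a parity count modulo `4`
and `8` (`IdealLattice.exists_isArakelovModular`).

*Necessity.* If `ℓ = β²` with `β ∈ K`, then `ℓ` is a square in `M`, and so is `± p ≡ 1 mod 4`. As
`M / ℚ` is cyclic, one of `ℓ`, `± p`, `± p ℓ` is a square in `ℚ`
(`isSquare_or_isSquare_or_isSquare_mul_of_isCyclic`). For squarefree `ℓ > 0` this forces `ℓ = 1`, or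
`ℓ = p` and `p ≡ 1 mod 4` (`eq_one_or_eq_of_sq_eq_natCast`).
-/

/-! ### Ramification and different of a quadratic subfield of a cyclotomic field -/

theorem Algebra.adjoin_singleton_eq_top_of_tower (R S : Type*) {A : Type*} [CommRing R]
    [CommRing S] [CommRing A] [Algebra R S] [Algebra S A] [Algebra R A] [IsScalarTower R S A]
    {x : A} (h : Algebra.adjoin R {x} = ⊤) : Algebra.adjoin S {x} = ⊤ := by
  have hle : Algebra.adjoin R {x} ≤ (Algebra.adjoin S {x}).restrictScalars R :=
    Algebra.adjoin_le Algebra.subset_adjoin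
  exact top_le_iff.1 fun y _ => hle (h ▸ Algebra.mem_top)

namespace RealCyclotomicTower

section

variable {n : ℕ} [NeZero n] {K L : Type*} [Field K] [Field L] [Algebra K L] {ζ : L}
  (hζ : IsPrimitiveRoot ζ n)

theorem toInteger_mul_inv_toInteger : hζ.toInteger * hζ.inv.toInteger = 1 := by
  ext
  exact mul_inv_cancel₀ (hζ.ne_zero (NeZero.ne _))

/-- Over `𝓞 L` the element `2 - ζ - ζ⁻¹` is the square of `ζ - 1` up to the unit `-ζ⁻¹`. -/
theorem associated_two_sub {g : 𝓞 K}
    (hg : algebraMap (𝓞 K) (𝓞 L) g = hζ.toInteger + hζ.inv.toInteger) :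
    Associated (algebraMap (𝓞 K) (𝓞 L) (2 - g)) ((hζ.toInteger - 1) ^ 2) := by
  have h1 := toInteger_mul_inv_toInteger hζ
  refine ⟨-⟨hζ.toInteger, hζ.inv.toInteger, h1, by rw [mul_comm, h1]⟩, ?_⟩
  rw [map_sub, hg, map_ofNat, Units.val_neg]
  linear_combination h1

end

section

variable {p k : ℕ} [Fact p.Prime] {K L : Type*} [Field K] [NumberField K] [Field L] [NumberField L]
  [Algebra K L] [IsCyclotomicExtension {p ^ (k + 1)} ℚ L] {ζ : L}
  (hζ : IsPrimitiveRoot ζ (p ^ (k + 1))) {g : 𝓞 K}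
  (hg : algebraMap (𝓞 K) (𝓞 L) g = hζ.toInteger + hζ.inv.toInteger)

include hζ in
theorem adjoin_zeta_eq_top : Algebra.adjoin K {ζ} = ⊤ :=
  Algebra.adjoin_singleton_eq_top_of_tower ℚ K
    (IsCyclotomicExtension.adjoin_primitive_root_eq_top hζ)

include hg

variable (h2 : Module.finrank K L = 2)

include h2

/-- The norm of the extended ideal is on the one hand the square of the norm, on the other hand the
norm of `(ζ - 1)²`. -/
theorem absNorm_span_two_sub : (Ideal.span {2 - g}).absNorm = p := by
  have h := Ideal.absNorm_algebraMap (R := 𝓞 K) (S := 𝓞 L) (Ideal.span {2 - g})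
  rw [Ideal.map_span, Set.image_singleton,
    Ideal.span_singleton_eq_span_singleton.2 (associated_two_sub hζ hg),
    ← Ideal.span_singleton_pow, map_pow,
    IsCyclotomicExtension.Rat.absNorm_span_zeta_sub_one p k hζ,
    ← IsFractionRing.finrank_eq (𝓞 K) K (𝓞 L) L, h2] at h
  exact (Nat.pow_left_injective (n := 2) (by norm_num) h).symm

theorem prime_span_two_sub : Prime (Ideal.span {2 - g}) := by
  have h := absNorm_span_two_sub hζ hg h2
  have hp := (Fact.out : p.Prime)
  have h0 : Ideal.span {2 - g} ≠ ⊥ := by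
    intro h'
    rw [h', Ideal.absNorm_bot] at h
    exact hp.ne_zero h.symm
  refine Ideal.prime_of_isPrime h0 (Ideal.isPrime_of_irreducible_absNorm ?_)
  rw [h]
  exact hp

/-- `p` is totally ramified in `K`, with `2 - ζ - ζ⁻¹` generating the prime above it. -/
theorem span_natCast_eq_pow :
    Ideal.span {(p : 𝓞 K)} = Ideal.span {2 - g} ^ Module.finrank ℚ K := by
  apply Ideal.map_injective_of_faithfullyFlat (A := 𝓞 K) (B := 𝓞 L)
  have h := IsCyclotomicExtension.Rat.map_eq_span_zeta_sub_one_pow p k hζ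
  rw [Ideal.map_span, Set.image_singleton, ← Module.finrank_mul_finrank ℚ K L, h2, mul_comm,
    pow_mul, Ideal.span_singleton_pow _ 2,
    ← Ideal.span_singleton_eq_span_singleton.2 (associated_two_sub hζ hg)] at h
  rw [Ideal.map_pow, Ideal.map_span, Ideal.map_span, Set.image_singleton, Set.image_singleton, ← h]
  simp

/-- A square root of `p` generates the power of the prime above `p` with half the exponent. -/
theorem span_sqrt_eq_pow {s : 𝓞 K} (hs : s ^ 2 = p) :
    ∃ b, Ideal.span {s} = Ideal.span {2 - g} ^ b ∧ 2 * b = Module.finrank ℚ K := by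
  have hP := prime_span_two_sub hζ hg h2
  have h := span_natCast_eq_pow hζ hg h2
  rw [← hs, ← Ideal.span_singleton_pow] at h
  obtain ⟨b, -, hb⟩ := (dvd_prime_pow hP _).1 (h ▸ dvd_pow_self (Ideal.span {s}) two_ne_zero)
  rw [associated_iff_eq] at hb
  refine ⟨b, hb, ?_⟩
  rw [hb, ← pow_mul, mul_comm] at h
  exact pow_injective_of_not_isUnit hP.not_isUnit hP.ne_zero h

open Polynomial in
theorem minpoly_toInteger : minpoly (𝓞 K) hζ.toInteger = X ^ 2 - C g * X + 1 := by
  have hint : IsIntegral (𝓞 K) hζ.toInteger := Algebra.IsIntegral.isIntegral _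
  have hmonic : (X ^ 2 - C g * X + 1 : (𝓞 K)[X]).Monic := by monicity!
  have hdeg : (X ^ 2 - C g * X + 1 : (𝓞 K)[X]).natDegree = 2 := by compute_degree!
  symm
  refine eq_of_monic_of_dvd_of_natDegree_le (minpoly.monic hint) hmonic
    (minpoly.isIntegrallyClosed_dvd hint ?_) ?_
  · simp only [map_add, map_sub, map_mul, map_pow, aeval_X, aeval_C, map_one, hg]
    linear_combination -toInteger_mul_inv_toInteger hζ
  · have htop : IntermediateField.adjoin K {ζ} = ⊤ := by
      rw [← IntermediateField.toSubalgebra_inj, IntermediateField.top_toSubalgebra,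
        ← adjoin_zeta_eq_top (K := K) hζ]
      exact IntermediateField.adjoin_simple_toSubalgebra_of_isAlgebraic
        (Algebra.IsAlgebraic.isAlgebraic ζ)
    rw [hdeg, ← h2, ← (minpoly.monic hint).natDegree_map (algebraMap (𝓞 K) K),
      ← minpoly.isIntegrallyClosed_eq_field_fractions K L hint]
    change _ ≤ (minpoly K ζ).natDegree
    rw [← IntermediateField.adjoin.finrank (Algebra.IsIntegral.isIntegral ζ), htop,
      IntermediateField.finrank_top']

/-- `𝓞 L = 𝓞 K[ζ]`, so the relative different is generated by the derivative `ζ - ζ⁻¹` of the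
minimal polynomial `X² - (ζ + ζ⁻¹)X + 1` at `ζ`. -/
theorem differentIdeal_eq_span :
    differentIdeal (𝓞 K) (𝓞 L) = Ideal.span {hζ.toInteger - hζ.inv.toInteger} := by
  have h := conductor_mul_differentIdeal (𝓞 K) K L hζ.toInteger
    (adjoin_zeta_eq_top (K := K) hζ)
  rw [conductor_eq_top_of_adjoin_eq_top
    (Algebra.adjoin_singleton_eq_top_of_tower ℤ (𝓞 K)
      (IsCyclotomicExtension.Rat.adjoin_singleton_eq_top hζ)), Ideal.top_mul,
    minpoly_toInteger hζ hg h2] at h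
  rw [h]
  congr 2
  simp only [Polynomial.derivative_X_sq, Polynomial.derivative_C_mul,
    Polynomial.derivative_X, Polynomial.derivative_one, map_add, map_sub, map_mul,
    Polynomial.aeval_X, Polynomial.aeval_C, map_zero, map_one, map_ofNat, hg]
  ring

/-- `ζ - ζ⁻¹ = ζ⁻¹(ζ² - 1)` is associated to `ζ - 1`, since `2` is prime to `p`. -/
theorem absNorm_differentIdeal_relative (hp : p ≠ 2) :
    (differentIdeal (𝓞 K) (𝓞 L)).absNorm = p := by
  have h1 := toInteger_mul_inv_toInteger hζ
  rw [differentIdeal_eq_span hζ hg h2]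
  refine Eq.trans (congrArg _ ?_) (IsCyclotomicExtension.Rat.absNorm_span_zeta_sub_one p k hζ)
  rw [Ideal.span_singleton_eq_span_singleton]
  have hcop : Nat.Coprime 2 (p ^ (k + 1)) :=
    ((Nat.coprime_primes Nat.prime_two Fact.out).2 hp.symm).pow_right _
  refine Associated.trans ?_
    (hζ.toInteger_isPrimitiveRoot.associated_sub_one_pow_sub_one_of_coprime hcop).symm
  refine ⟨⟨hζ.toInteger, hζ.inv.toInteger, h1, by rw [mul_comm, h1]⟩, ?_⟩
  linear_combination -h1

/-- The different of `K` is a power of the prime above `p`. The exponent is read off from the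
discriminants of `L` and `K` and the norm of the relative different. -/
theorem differentIdeal_int_eq_pow (hp : p ≠ 2) :
    ∃ e, differentIdeal ℤ (𝓞 K) = Ideal.span {2 - g} ^ e ∧
      2 * e + 1 = p ^ k * ((p - 1) * (k + 1) - 1) := by
  have hpp := (Fact.out : p.Prime)
  have hP := prime_span_two_sub hζ hg h2
  have h := natAbs_discr_eq_absNorm_differentIdeal_mul_natAbs_discr_pow K (𝓞 K) L (𝓞 L)
  rw [IsCyclotomicExtension.Rat.discr_prime_pow_succ p k L,
    absNorm_differentIdeal_relative hζ hg h2 hp, h2] at h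
  simp only [Int.natAbs_mul, Int.natAbs_pow, Int.natAbs_neg, Int.natAbs_one, one_pow, one_mul,
    Int.natAbs_natCast] at h
  obtain ⟨m, -, hm⟩ := (Nat.dvd_prime_pow hpp).1 (h ▸ (dvd_pow_self _ two_ne_zero).mul_left p :
    (discr K).natAbs ∣ p ^ _)
  -- The different contains its norm, a power of `p`, so it divides a power of the prime above `p`.
  have hmem : differentIdeal ℤ (𝓞 K) ∣ Ideal.span {2 - g} ^ (Module.finrank ℚ K * m) := by
    rw [pow_mul, ← span_natCast_eq_pow hζ hg h2, Ideal.span_singleton_pow, Ideal.dvd_span_singleton,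
      ← Nat.cast_pow, ← hm, ← absNorm_differentIdeal K (𝒪 := 𝓞 K)]
    exact Ideal.absNorm_mem _
  obtain ⟨e, -, he⟩ := (dvd_prime_pow hP _).1 hmem
  rw [associated_iff_eq] at he
  refine ⟨e, he, ?_⟩
  have hN := absNorm_differentIdeal K (𝒪 := 𝓞 K)
  rw [he, map_pow, absNorm_span_two_sub hζ hg h2, hm] at hN
  have hem := Nat.pow_right_injective hpp.two_le hN
  rw [hm, ← hem, ← pow_mul, ← pow_succ'] at h
  have := Nat.pow_right_injective hpp.two_le h
  omega

end
end RealCyclotomicTower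

/-! ### Square roots of integers in a cyclotomic field -/

/-- A cyclic extension of `F` has at most one quadratic subextension: if `a` and `b` become squares
in it, then `a`, `b` or `a * b` is already a square in `F`. -/
theorem isSquare_or_isSquare_or_isSquare_mul_of_isCyclic {F L : Type*} [Field F] [Field L]
    [Algebra F L] [FiniteDimensional F L] [IsGalois F L] [IsCyclic Gal(L/F)] {a b : F} {x y : L}
    (hx : x ^ 2 = algebraMap F L a) (hy : y ^ 2 = algebraMap F L b) :
    IsSquare a ∨ IsSquare b ∨ IsSquare (a * b) := by
  obtain ⟨σ, hσ⟩ := IsCyclic.exists_generator (α := Gal(L/F))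
  have hfix : ∀ z : L, σ z = z → ∀ c : F, z ^ 2 = algebraMap F L c → IsSquare c := by
    intro z hz c hc
    have hall : ∀ τ : Gal(L/F), τ z = z := by
      intro τ
      have hle : Subgroup.zpowers σ ≤ MulAction.stabilizer Gal(L/F) z := by
        rw [Subgroup.zpowers_le]
        exact hz
      exact hle (hσ τ)
    obtain ⟨d, rfl⟩ := (IsGalois.mem_range_algebraMap_iff_fixed z).2 hall
    refine ⟨d, (algebraMap F L).injective ?_⟩
    rw [← hc, map_mul, sq]
  have hsign : ∀ z : L, ∀ c : F, z ^ 2 = algebraMap F L c → σ z = z ∨ σ z = -z := by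
    intro z c hc
    rw [← sq_eq_sq_iff_eq_or_eq_neg, ← map_pow, hc, AlgEquiv.commutes]
  -- A generator `σ` fixes `x` or `y`, or else negates both and fixes `x * y`.
  rcases hsign x a hx with h | h
  · exact Or.inl (hfix x h a hx)
  rcases hsign y b hy with h' | h'
  · exact Or.inr (Or.inl (hfix y h' b hy))
  · refine Or.inr (Or.inr (hfix (x * y) ?_ _ ?_))
    · rw [map_mul, h, h', neg_mul_neg]
    · rw [mul_pow, hx, hy, map_mul]

/-- The square root of `±p` is the quadratic Gauss sum. -/
theorem exists_sq_eq_χ₄_mul {p : ℕ} [Fact p.Prime] (hp : p ≠ 2) {F : Type*} [Field F] [CharZero F]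
    {η : F} (hη : IsPrimitiveRoot η p) : ∃ s : F, s ^ 2 = ((ZMod.χ₄ p * p : ℤ) : F) := by
  have hc : ringChar (ZMod p) ≠ 2 := by rwa [ZMod.ringChar_zmod_n]
  refine ⟨_, (gaussSum_sq (χ := (quadraticChar (ZMod p)).ringHomComp (Int.castRingHom F)) ?_ ?_
    (AddChar.zmodChar_primitive_of_primitive_root p hη)).trans ?_⟩
  · exact (MulChar.ringHomComp_ne_one_iff Int.cast_injective).2 (quadraticChar_ne_one hc)
  · exact (quadraticChar_isQuadratic (ZMod p)).comp _
  · rw [MulChar.ringHomComp_apply, quadraticChar_neg_one hc, ZMod.card]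
    simp

theorem Nat.eq_of_squarefree_of_isSquare_mul {a b : ℕ} (ha : Squarefree a) (hb : Squarefree b)
    (h : IsSquare (a * b)) : a = b := by
  obtain ⟨r, hr⟩ := h
  obtain ⟨c, rfl⟩ : a ∣ r := by
    rw [← ha.dvd_pow_iff_dvd two_ne_zero, sq, ← hr]
    exact dvd_mul_right a b
  have hbc : b = a * (c * c) :=
    Nat.eq_of_mul_eq_mul_left (Nat.pos_of_ne_zero ha.ne_zero) (by rw [hr]; ring)
  have hc : c = 1 := Nat.isUnit_iff.1 (hb c (hbc ▸ dvd_mul_left _ _))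
  rw [hbc, hc, mul_one, mul_one]

/-- The square roots of squarefree positive integers in the `p ^ (k + 1)`-th cyclotomic field. -/
theorem eq_one_or_eq_of_sq_eq_natCast {p k : ℕ} [Fact p.Prime] (hp : p ≠ 2) {L : Type*} [Field L]
    [NumberField L] [IsCyclotomicExtension {p ^ (k + 1)} ℚ L] {ζ : L}
    (hζ : IsPrimitiveRoot ζ (p ^ (k + 1))) {l : ℕ} (hl : Squarefree l) {β : L}
    (hβ : β ^ 2 = l) : l = 1 ∨ l = p ∧ p % 4 = 1 := by
  have hpp := (Fact.out : p.Prime)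
  have hη : IsPrimitiveRoot (ζ ^ p ^ k) p :=
    hζ.pow (pow_pos hpp.pos _) (pow_succ p k)
  obtain ⟨s, hs⟩ := exists_sq_eq_χ₄_mul hp hη
  have : IsGalois ℚ L := IsCyclotomicExtension.isGalois {p ^ (k + 1)} ℚ L
  have : IsCyclic (ZMod (p ^ (k + 1)))ˣ := ZMod.isCyclic_units_of_prime_pow p hpp hp _
  have : IsCyclic Gal(L/ℚ) := isCyclic_of_surjective
    (IsCyclotomicExtension.Rat.galEquivZMod (p ^ (k + 1)) L).symm
    (MulEquiv.surjective _)
  have h := isSquare_or_isSquare_or_isSquare_mul_of_isCyclic (F := ℚ) (L := L)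
    (a := ((l : ℤ) : ℚ)) (b := ((ZMod.χ₄ p * p : ℤ) : ℚ)) (x := β) (y := s)
    (by simpa using hβ) (by simpa using hs)
  rw [← Int.cast_mul, Rat.isSquare_intCast_iff, Rat.isSquare_intCast_iff,
    Rat.isSquare_intCast_iff] at h
  have hmod := Nat.odd_mod_four_iff.1 (hpp.eq_two_or_odd.resolve_left hp)
  have hpsq : ¬ IsSquare p := hpp.prime.not_isSquare
  have hl0 : 0 < l := Nat.pos_of_ne_zero hl.ne_zero
  rcases hmod with h1 | h3
  · rw [ZMod.χ₄_nat_one_mod_four h1, one_mul, ← Nat.cast_mul, Int.isSquare_natCast_iff,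
      Int.isSquare_natCast_iff, Int.isSquare_natCast_iff] at h
    rcases h with h | h | h
    · exact Or.inl (Nat.eq_of_squarefree_of_isSquare_mul hl squarefree_one (by rwa [mul_one]))
    · exact absurd h hpsq
    · exact Or.inr ⟨Nat.eq_of_squarefree_of_isSquare_mul hl hpp.prime.squarefree h, h1⟩
  · rw [ZMod.χ₄_nat_three_mod_four h3, Int.isSquare_natCast_iff] at h
    rcases h with h | h | h
    · exact Or.inl (Nat.eq_of_squarefree_of_isSquare_mul hl squarefree_one (by rwa [mul_one]))
    · have := h.nonneg
      have := hpp.pos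
      omega
    · have := h.nonneg
      have : (0 : ℤ) < l * p := by exact_mod_cast Nat.mul_pos hl0 hpp.pos
      linarith

noncomputable section

/-! ### Lattices supported on powers of one ideal -/

namespace IdealLattice

/-- If the different is `J ^ e`, `(α) = J ^ a`, `(β) = J ^ b`, then `J ^ m` solves the equation
`I = β I^*` as soon as `b = a + e + 2 * m`. -/
theorem exists_isArakelovModular {K : Type*} [Field K] [NumberField K] [IsTotallyReal K]
    {J : FractionalIdeal (𝓞 K)⁰ K} (hJ : J ≠ 0) {e : ℕ} {a b m : ℤ}
    (hD : (differentIdeal ℤ (𝓞 K) : FractionalIdeal (𝓞 K)⁰ K) = J ^ e) {α β : K} (hα : α ≠ 0)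
    (hpos : ∀ σ : K →+* ℝ, 0 < σ α) (hβ : β ≠ 0)
    (hαJ : FractionalIdeal.spanSingleton (𝓞 K)⁰ α = J ^ a)
    (hβJ : FractionalIdeal.spanSingleton (𝓞 K)⁰ β = J ^ b) (hb : b = a + e + 2 * m) {l : ℕ}
    (hl : (l : K) = β * β) : ∃ L : IdealLattice K, L.α = α ∧ L.IsArakelovModular l := by
  refine ⟨⟨J ^ m, zpow_ne_zero m hJ, α, hα, hpos⟩, rfl, β, hβ, ?_, hl⟩
  rw [dual, ← FractionalIdeal.spanSingleton_inv, hαJ, hβJ, hD, ← zpow_natCast, ← zpow_neg,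
    ← zpow_neg, ← zpow_neg, ← zpow_add₀ hJ, ← zpow_add₀ hJ, ← zpow_add₀ hJ]
  change J ^ m = _
  congr 1
  omega

end IdealLattice

/-! ### The extension `ℚ(ζ_n) / ℚ(ζ_n + ζ_n⁻¹)` -/

namespace RealCyclotomic

variable (n : ℕ)

/-- The cyclotomic field `ℚ(ζ_n)`, as an extension of its subfield `ℚ(ζ_n + ζ_n⁻¹)`. -/
abbrev Cyclotomic : IntermediateField (RealCyclotomic n) ℂ :=
  IntermediateField.adjoin (RealCyclotomic n) {zetaRoot n}

/-- `ζ_n` as an element of `ℚ(ζ_n)`. -/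
def zeta : Cyclotomic n := ⟨zetaRoot n, IntermediateField.mem_adjoin_simple_self _ _⟩

/-- `ζ_n + ζ_n⁻¹` as an element of `ℚ(ζ_n + ζ_n⁻¹)`. -/
def gen : RealCyclotomic n :=
  ⟨zetaRoot n + (zetaRoot n)⁻¹, IntermediateField.mem_adjoin_simple_self _ _⟩

theorem algebraMap_gen : algebraMap _ (Cyclotomic n) (gen n) = zeta n + (zeta n)⁻¹ := rfl

variable [NeZero n]

theorem zeta_isPrimitiveRoot : IsPrimitiveRoot (zeta n) n :=
  IsPrimitiveRoot.coe_submonoidClass_iff.1 (zetaRoot_isPrimitiveRoot n)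

instance : NumberField (Cyclotomic n) where
  to_charZero := inferInstance
  to_finiteDimensional :=
    have : FiniteDimensional (RealCyclotomic n) (Cyclotomic n) :=
      IntermediateField.adjoin.finiteDimensional (zetaRoot_isIntegral n).tower_top
    FiniteDimensional.trans ℚ (RealCyclotomic n) (Cyclotomic n)

instance : IsCyclotomicExtension {n} ℚ (Cyclotomic n) := by
  have h : (Cyclotomic n).restrictScalars ℚ = IntermediateField.adjoin ℚ {zetaRoot n} := by
    refine (IntermediateField.adjoin_adjoin_left ℚ {zetaRoot n + (zetaRoot n)⁻¹}
      {zetaRoot n}).trans ?_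
    refine le_antisymm (IntermediateField.adjoin_le_iff.2 ?_)
      (IntermediateField.adjoin.mono _ _ _ Set.subset_union_right)
    have hz := IntermediateField.mem_adjoin_simple_self ℚ (zetaRoot n)
    rintro x (rfl | rfl)
    · exact add_mem hz (inv_mem hz)
    · exact hz
  have h' : Algebra.adjoin ℚ {zetaRoot n} = ((Cyclotomic n).restrictScalars ℚ).toSubalgebra := by
    rw [h, IntermediateField.adjoin_simple_toSubalgebra_of_isAlgebraic
      (zetaRoot_isIntegral n).isAlgebraic]
  have := (zetaRoot_isPrimitiveRoot n).adjoin_isCyclotomicExtension ℚ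
  exact IsCyclotomicExtension.equiv {n} ℚ _ (Subalgebra.equivOfEq _ _ h')

theorem conj_eq_self (x : RealCyclotomic n) : (starRingEnd ℂ) (x : ℂ) = x := by
  have h := IsTotallyReal.isReal (InfinitePlace.mk (RealCyclotomic n).val.toRingHom)
  rw [InfinitePlace.isReal_mk_iff] at h
  exact RingHom.congr_fun h x

theorem conj_zetaRoot_ne (hn : 2 < n) : (starRingEnd ℂ) (zetaRoot n) ≠ zetaRoot n := by
  intro h1
  have hz := zetaRoot_isPrimitiveRoot n
  rw [← Complex.inv_eq_conj (Complex.norm_eq_one_of_pow_eq_one hz.pow_eq_one (NeZero.ne n)),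
    inv_eq_iff_eq_inv] at h1
  have h2 := mul_inv_cancel₀ (hz.ne_zero (NeZero.ne n))
  rw [← h1, ← sq] at h2
  exact absurd (Nat.le_of_dvd two_pos (hz.dvd_of_pow_eq_one 2 h2)) (by omega)

open Polynomial in
/-- `ζ_n` is a root of `X² - (ζ_n + ζ_n⁻¹) X + 1` and, not being real, lies outside the subfield. -/
theorem finrank_cyclotomic (hn : 2 < n) :
    Module.finrank (RealCyclotomic n) (Cyclotomic n) = 2 := by
  have hint : IsIntegral (RealCyclotomic n) (zetaRoot n) := (zetaRoot_isIntegral n).tower_top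
  rw [IntermediateField.adjoin.finrank hint]
  have hpos := minpoly.natDegree_pos hint
  have hne : (minpoly (RealCyclotomic n) (zetaRoot n)).natDegree ≠ 1 := by
    rw [Ne, minpoly.natDegree_eq_one_iff]
    rintro ⟨x, hx⟩
    exact conj_zetaRoot_ne n hn (hx ▸ conj_eq_self n x)
  have hle : (minpoly (RealCyclotomic n) (zetaRoot n)).natDegree ≤ 2 := by
    have hQ : (X ^ 2 - C (gen n) * X + 1 : (RealCyclotomic n)[X]).Monic := by monicity!
    refine (natDegree_le_of_dvd (minpoly.dvd _ _ ?_) hQ.ne_zero).trans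
      (by compute_degree!)
    have hz := mul_inv_cancel₀ ((zetaRoot_isPrimitiveRoot n).ne_zero (NeZero.ne n))
    simp only [map_add, map_sub, map_mul, map_pow, aeval_X, aeval_C, map_one]
    change _ - (zetaRoot n + (zetaRoot n)⁻¹) * _ + _ = _
    linear_combination -hz
  omega

/-- `ℚ(ζ_n + ζ_n⁻¹)` contains all real elements of `ℚ(ζ_n)`: in `x = a ζ_n + b` with `x` real and
`a`, `b` in the subfield, the coefficient `a` must vanish, since `ζ_n` is not real. -/
theorem mem_range_of_conj_eq_self (hn : 2 < n) {x : Cyclotomic n}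
    (hx : (starRingEnd ℂ) (x : ℂ) = x) :
    ∃ y, algebraMap (RealCyclotomic n) (Cyclotomic n) y = x := by
  have hint : IsIntegral (RealCyclotomic n) (zetaRoot n) := (zetaRoot_isIntegral n).tower_top
  obtain ⟨f, hf, rfl⟩ := (IntermediateField.adjoin.powerBasis hint).exists_eq_aeval x
  rw [← PowerBasis.finrank, finrank_cyclotomic n hn] at hf
  obtain ⟨a, b, rfl⟩ := Polynomial.exists_eq_X_add_C_of_natDegree_le_one (Nat.lt_succ_iff.1 hf)
  have hval : ((Polynomial.aeval (IntermediateField.adjoin.powerBasis hint).gen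
      (Polynomial.C a * Polynomial.X + Polynomial.C b) : Cyclotomic n) : ℂ) =
      a * zetaRoot n + b := by
    simp only [map_add, map_mul, Polynomial.aeval_X, Polynomial.aeval_C,
      IntermediateField.adjoin.powerBasis_gen]
    rfl
  rw [hval, map_add, map_mul, conj_eq_self, conj_eq_self, add_left_inj] at hx
  by_cases ha : a = 0
  · exact ⟨b, by simp [ha]⟩
  · exact absurd (mul_left_cancel₀ (by simpa using ha) hx) (conj_zetaRoot_ne n hn)

theorem isIntegral_gen : IsIntegral ℤ (gen n) := by
  have hz := zetaRoot_isPrimitiveRoot n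
  have hpos := Nat.pos_of_ne_zero (NeZero.ne n)
  rw [← isIntegral_algebraMap_iff (algebraMap (RealCyclotomic n) ℂ).injective]
  exact (hz.isIntegral hpos).add (hz.inv.isIntegral hpos)

/-- The conjugates of `2 - ζ_n - ζ_n⁻¹` are the numbers `|1 - ζ|²` for primitive `n`-th roots of
unity `ζ`. -/
theorem two_sub_gen_totallyPositive (hn : 1 < n) (σ : RealCyclotomic n →+* ℝ) :
    0 < σ (2 - gen n) := by
  let φ : RealCyclotomic n →+* ℂ := Complex.ofRealHom.comp σ
  let ψ : Cyclotomic n →+* ℂ := ComplexEmbedding.lift (Cyclotomic n) φ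
  have hψ : IsPrimitiveRoot (ψ (zeta n)) n := (zeta_isPrimitiveRoot n).map_of_injective ψ.injective
  have hconj := Complex.inv_eq_conj (Complex.norm_eq_one_of_pow_eq_one hψ.pow_eq_one (NeZero.ne n))
  have h0 := mul_inv_cancel₀ (hψ.ne_zero (NeZero.ne n))
  have h1 : φ (2 - gen n) = ψ (2 - (zeta n + (zeta n)⁻¹)) :=
    (ComplexEmbedding.lift_algebraMap_apply (Cyclotomic n) φ _).symm
  have hφ : φ (2 - gen n) = Complex.normSq (1 - ψ (zeta n)) := by
    rw [h1, map_sub ψ, map_ofNat ψ, map_add ψ, map_inv₀ ψ, Complex.normSq_eq_conj_mul_self,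
      map_sub, map_one, ← hconj]
    linear_combination -h0
  rw [Complex.ofReal_injective hφ, Complex.normSq_pos, sub_ne_zero]
  exact (hψ.ne_one hn).symm

omit [NeZero n] in
theorem coe_two_sub_gen :
    ((2 - gen n : RealCyclotomic n) : ℂ) = ((2 - 2 * Real.cos (2 * Real.pi / n) : ℝ) : ℂ) := by
  change (2 : ℂ) - (zetaRoot n + (zetaRoot n)⁻¹) = _
  push_cast
  rw [Complex.two_cos, zetaRoot, ← Complex.exp_neg]
  ring_nf

end RealCyclotomic

/-! ### The ideals above `p` in `ℚ(ζ + ζ⁻¹)` -/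

namespace RealCyclotomic

section

variable (n : ℕ) [NeZero n]

/-- `ζ_n + ζ_n⁻¹` as an algebraic integer. -/
def intGen : 𝓞 (RealCyclotomic n) := ⟨gen n, isIntegral_gen n⟩

theorem algebraMap_intGen :
    algebraMap _ (𝓞 (Cyclotomic n)) (intGen n) =
      (zeta_isPrimitiveRoot n).toInteger + (zeta_isPrimitiveRoot n).inv.toInteger := rfl

/-- The principal fractional ideal generated by `2 - ζ_n - ζ_n⁻¹`. -/
def ramifiedIdeal : FractionalIdeal (𝓞 (RealCyclotomic n))⁰ (RealCyclotomic n) :=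
  FractionalIdeal.spanSingleton _ (2 - gen n)

theorem coeIdeal_span_two_sub_intGen :
    ((Ideal.span {2 - intGen n} : Ideal (𝓞 (RealCyclotomic n))) :
      FractionalIdeal (𝓞 (RealCyclotomic n))⁰ (RealCyclotomic n)) = ramifiedIdeal n := by
  rw [FractionalIdeal.coeIdeal_span_singleton]
  rfl

variable {n} in
theorem two_sub_gen_ne_zero (hn : 1 < n) : 2 - gen n ≠ 0 := by
  intro h
  have hz := zetaRoot_isPrimitiveRoot n
  have h0 : (2 : ℂ) - (zetaRoot n + (zetaRoot n)⁻¹) = 0 := congrArg Subtype.val h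
  have h1 : (zetaRoot n - 1) ^ 2 = 0 := by
    linear_combination -zetaRoot n * h0 - mul_inv_cancel₀ (hz.ne_zero (NeZero.ne n))
  exact hz.ne_one hn (sub_eq_zero.1 (pow_eq_zero_iff two_ne_zero |>.1 h1))

variable {n} in
theorem ramifiedIdeal_ne_zero (hn : 1 < n) : ramifiedIdeal n ≠ 0 :=
  FractionalIdeal.spanSingleton_ne_zero_iff.2 (two_sub_gen_ne_zero hn)

end

variable {p k : ℕ} [Fact p.Prime]

theorem two_lt_prime_pow (hp : p ≠ 2) : 2 < p ^ (k + 1) :=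
  lt_of_lt_of_le (lt_of_le_of_ne (Fact.out : p.Prime).two_le hp.symm) (Nat.le_self_pow (by omega) p)

theorem coeIdeal_differentIdeal_eq_pow (hp : p ≠ 2) :
    ∃ e : ℕ, (differentIdeal ℤ (𝓞 (RealCyclotomic (p ^ (k + 1)))) :
      FractionalIdeal (𝓞 (RealCyclotomic (p ^ (k + 1))))⁰ (RealCyclotomic (p ^ (k + 1)))) =
        ramifiedIdeal (p ^ (k + 1)) ^ e ∧ 2 * e + 1 = p ^ k * ((p - 1) * (k + 1) - 1) := by
  obtain ⟨e, he, h⟩ := RealCyclotomicTower.differentIdeal_int_eq_pow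
    (zeta_isPrimitiveRoot (p ^ (k + 1))) (algebraMap_intGen _)
    (finrank_cyclotomic _ (two_lt_prime_pow hp)) hp
  exact ⟨e, by rw [he, FractionalIdeal.coeIdeal_pow, coeIdeal_span_two_sub_intGen], h⟩

/-- For `p ≡ 1 mod 4` the quadratic Gauss sum is a real square root of `p`, so it lies in
`ℚ(ζ + ζ⁻¹)`; it generates a power of the prime above `p`. -/
theorem exists_sq_eq_prime (hp : p % 4 = 1) :
    ∃ (s : RealCyclotomic (p ^ (k + 1))) (b : ℕ), s * s = p ∧
      FractionalIdeal.spanSingleton _ s = ramifiedIdeal (p ^ (k + 1)) ^ b ∧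
      4 * b = p ^ k * (p - 1) := by
  have hp2 : p ≠ 2 := by rintro rfl; omega
  have hn := two_lt_prime_pow (k := k) hp2
  have hζ := zeta_isPrimitiveRoot (p ^ (k + 1))
  have hpp := (Fact.out : p.Prime)
  obtain ⟨x, hx⟩ := exists_sq_eq_χ₄_mul hp2 (hζ.pow (pow_pos hpp.pos _) (pow_succ p k))
  rw [ZMod.χ₄_nat_one_mod_four hp, one_mul, Int.cast_natCast] at hx
  have hxC : (x : ℂ) ^ 2 = ((√p : ℝ) : ℂ) ^ 2 := by
    rw [← Complex.ofReal_pow, Real.sq_sqrt (Nat.cast_nonneg p), Complex.ofReal_natCast]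
    exact congrArg Subtype.val hx
  have hreal : (starRingEnd ℂ) (x : ℂ) = x := by
    rcases sq_eq_sq_iff_eq_or_eq_neg.1 hxC with h | h <;> rw [h] <;> simp
  obtain ⟨s, rfl⟩ := mem_range_of_conj_eq_self (p ^ (k + 1)) hn hreal
  replace hx : s ^ 2 = p :=
    (algebraMap (RealCyclotomic (p ^ (k + 1))) (Cyclotomic (p ^ (k + 1)))).injective
      (by rw [map_pow, hx, map_natCast])
  have hint : IsIntegral ℤ s := by
    refine IsIntegral.of_pow two_pos ?_
    rw [hx]
    exact map_natCast (algebraMap ℤ (RealCyclotomic (p ^ (k + 1)))) p ▸ isIntegral_algebraMap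
  obtain ⟨t, rfl⟩ :=
    (IsIntegralClosure.isIntegral_iff (A := 𝓞 (RealCyclotomic (p ^ (k + 1))))).1 hint
  have hs : t ^ 2 = p := RingOfIntegers.coe_injective (by simpa using hx)
  have h2 := finrank_cyclotomic _ hn
  obtain ⟨b, hb, hbd⟩ := RealCyclotomicTower.span_sqrt_eq_pow hζ (algebraMap_intGen _) h2 hs
  refine ⟨_, b, by rw [← sq, hx], ?_, ?_⟩
  · rw [← coeIdeal_span_two_sub_intGen, ← FractionalIdeal.coeIdeal_pow, ← hb,
      FractionalIdeal.coeIdeal_span_singleton]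
  · have hdeg := Module.finrank_mul_finrank ℚ (RealCyclotomic (p ^ (k + 1)))
      (Cyclotomic (p ^ (k + 1)))
    rw [h2, ← hbd, IsCyclotomicExtension.Rat.finrank (p ^ (k + 1)),
      Nat.totient_prime_pow_succ hpp] at hdeg
    omega

/-- The level of an Arakelov-modular lattice is a square in `K`, hence in the cyclotomic field. -/
theorem eq_one_or_eq_of_isArakelovModular (hp : p ≠ 2) {l : ℕ} (hl : Squarefree l)
    {L : IdealLattice (RealCyclotomic (p ^ (k + 1)))} (hL : L.IsArakelovModular l) :
    l = 1 ∨ l = p ∧ p % 4 = 1 := by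
  obtain ⟨β, -, -, hβ⟩ := hL
  refine eq_one_or_eq_of_sq_eq_natCast hp (zeta_isPrimitiveRoot (p ^ (k + 1))) hl
    (β := algebraMap _ _ β) ?_
  rw [← map_pow, sq, ← hβ, map_natCast]

end RealCyclotomic

/-! ### Parity and the lattices -/

/-- The exponent of the different is odd for `p ≡ 1 mod 4`. -/
theorem odd_of_two_mul_add_one_eq {p k e : ℕ} (hp : p % 4 = 1) (hp1 : 1 < p)
    (he : 2 * e + 1 = p ^ k * ((p - 1) * (k + 1) - 1)) : Odd e := by
  obtain ⟨q, rfl⟩ : ∃ q, p = 4 * q + 1 := ⟨p / 4, by omega⟩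
  have h1 : (4 * q + 1) ^ k ≡ 1 [MOD 4] := by
    simpa using (show 4 * q + 1 ≡ 1 [MOD 4] from hp).pow k
  have h2 : ((4 * q + 1 - 1) * (k + 1) - 1) ≡ 3 [MOD 4] := by
    rw [Nat.add_sub_cancel, mul_assoc]
    have : 0 < q * (k + 1) := Nat.mul_pos (by omega) (by omega)
    unfold Nat.ModEq
    omega
  have h3 := h1.mul h2
  rw [← he] at h3
  unfold Nat.ModEq at h3
  rw [Nat.odd_iff]
  omega

/-- The exponent of the different is even for `p ≡ 3 mod 4`. -/
theorem even_of_two_mul_add_one_eq {p k e : ℕ} (hp : p % 4 = 3)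
    (he : 2 * e + 1 = p ^ k * ((p - 1) * (k + 1) - 1)) : Even e := by
  obtain ⟨q, rfl⟩ : ∃ q, p = 4 * q + 3 := ⟨p / 4, by omega⟩
  have h0 : (4 * q + 3) ^ 2 ≡ 1 [MOD 4] := (show 4 * q + 3 ≡ 3 [MOD 4] from hp).pow 2
  have key : ∀ j, ((4 * q + 3) ^ 2) ^ j ≡ 1 [MOD 4] := fun j => by simpa using h0.pow j
  have h3 : 2 * e + 1 ≡ 1 [MOD 4] := by
    rw [he]
    -- As `p ≡ -1`, both factors are `1` or both are `-1` modulo `4`, according to the parity of `k`.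
    obtain ⟨j, rfl | rfl⟩ := Nat.even_or_odd' k
    · rw [pow_mul]
      refine ((key j).mul (?_ : _ ≡ 1 [MOD 4]))
      have : (4 * q + 3 - 1) * (2 * j + 1) = 4 * (q * (2 * j + 1) + j) + 2 := by
        rw [show 4 * q + 3 - 1 = 4 * q + 2 by omega]
        ring
      unfold Nat.ModEq
      omega
    · rw [pow_succ, pow_mul, mul_assoc]
      refine ((key j).mul (?_ : _ ≡ 1 [MOD 4]))
      have h' : ((4 * q + 3 - 1) * (2 * j + 1 + 1) - 1) ≡ 3 [MOD 4] := by
        have : (4 * q + 3 - 1) * (2 * j + 1 + 1) = 4 * ((2 * q + 1) * j + 2 * q) + 4 := by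
          rw [show 4 * q + 3 - 1 = 4 * q + 2 by omega]
          ring
        unfold Nat.ModEq
        omega
      exact (show 4 * q + 3 ≡ 3 [MOD 4] from hp).mul h'
  unfold Nat.ModEq at h3
  rw [Nat.even_iff]
  omega

namespace RealCyclotomic

variable {p k : ℕ} [Fact p.Prime]

theorem exists_isArakelovModular_one_of_mod_four_eq_one (hp : p % 4 = 1) :
    ∃ L : IdealLattice (RealCyclotomic (p ^ (k + 1))),
      L.α = (2 - gen (p ^ (k + 1)))⁻¹ ∧ L.IsArakelovModular 1 := by
  have hp2 : p ≠ 2 := by rintro rfl; omega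
  have hn : 1 < p ^ (k + 1) := one_lt_two.trans (two_lt_prime_pow hp2)
  obtain ⟨e, hD, he⟩ := coeIdeal_differentIdeal_eq_pow (k := k) hp2
  obtain ⟨m, hm⟩ := odd_of_two_mul_add_one_eq hp (Fact.out : p.Prime).one_lt he
  refine IdealLattice.exists_isArakelovModular (a := -1) (b := 0) (m := -m)
    (ramifiedIdeal_ne_zero hn) hD (inv_ne_zero (two_sub_gen_ne_zero hn)) (fun σ => ?_)
    (one_ne_zero : (1 : RealCyclotomic (p ^ (k + 1))) ≠ 0) ?_ ?_ ?_ ?_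
  · rw [map_inv₀]
    exact inv_pos.2 (two_sub_gen_totallyPositive _ hn σ)
  · rw [zpow_neg_one, ramifiedIdeal, FractionalIdeal.spanSingleton_inv]
  · rw [zpow_zero, FractionalIdeal.spanSingleton_one]
  · omega
  · simp

theorem exists_isArakelovModular_prime_of_mod_eight_eq_one (hp : p % 8 = 1) :
    ∃ L : IdealLattice (RealCyclotomic (p ^ (k + 1))),
      L.α = (2 - gen (p ^ (k + 1)))⁻¹ ∧ L.IsArakelovModular p := by
  have hpp := (Fact.out : p.Prime)
  have hp4 : p % 4 = 1 := by omega
  have hp2 : p ≠ 2 := by rintro rfl; omega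
  have hn : 1 < p ^ (k + 1) := one_lt_two.trans (two_lt_prime_pow hp2)
  obtain ⟨e, hD, he⟩ := coeIdeal_differentIdeal_eq_pow (k := k) hp2
  obtain ⟨m, hm⟩ := odd_of_two_mul_add_one_eq hp4 hpp.one_lt he
  obtain ⟨s, b, hs, hsJ, hb⟩ := exists_sq_eq_prime (k := k) hp4
  obtain ⟨c, hc⟩ : Even b := by
    obtain ⟨q, hq⟩ : ∃ q, p - 1 = 8 * q := ⟨p / 8, by omega⟩
    rw [hq] at hb
    exact ⟨p ^ k * q, by linarith⟩
  refine IdealLattice.exists_isArakelovModular (a := -1) (b := b) (m := c - m) (β := s)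
    (ramifiedIdeal_ne_zero hn) hD (inv_ne_zero (two_sub_gen_ne_zero hn)) (fun σ => ?_)
    ?_ ?_ ?_ ?_ hs.symm
  · rw [map_inv₀]
    exact inv_pos.2 (two_sub_gen_totallyPositive _ hn σ)
  · rintro rfl
    rw [mul_zero] at hs
    exact hpp.ne_zero (Nat.cast_eq_zero.1 hs.symm)
  · rw [zpow_neg_one, ramifiedIdeal, FractionalIdeal.spanSingleton_inv]
  · rw [hsJ, zpow_natCast]
  · omega

theorem exists_isArakelovModular_prime_of_mod_eight_eq_five (hp : p % 8 = 5) :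
    ∃ L : IdealLattice (RealCyclotomic (p ^ (k + 1))), L.α = 1 ∧ L.IsArakelovModular p := by
  have hpp := (Fact.out : p.Prime)
  have hp4 : p % 4 = 1 := by omega
  have hp2 : p ≠ 2 := by rintro rfl; omega
  have hn : 1 < p ^ (k + 1) := one_lt_two.trans (two_lt_prime_pow hp2)
  obtain ⟨e, hD, he⟩ := coeIdeal_differentIdeal_eq_pow (k := k) hp2
  obtain ⟨m, hm⟩ := odd_of_two_mul_add_one_eq hp4 hpp.one_lt he
  obtain ⟨s, b, hs, hsJ, hb⟩ := exists_sq_eq_prime (k := k) hp4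
  obtain ⟨c, hc⟩ : Odd b := by
    obtain ⟨q, hq⟩ : ∃ q, p - 1 = 4 * (2 * q + 1) := ⟨p / 8, by omega⟩
    have hbq : b = p ^ k * (2 * q + 1) := by
      rw [hq] at hb
      linarith
    rw [hbq]
    exact ((hpp.odd_of_ne_two hp2).pow).mul (odd_two_mul_add_one q)
  refine IdealLattice.exists_isArakelovModular (a := 0) (b := b) (m := c - m) (β := s)
    (ramifiedIdeal_ne_zero hn) hD one_ne_zero (fun σ => ?_) ?_ ?_ ?_ ?_ hs.symm
  · rw [map_one]
    exact one_pos
  · rintro rfl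
    rw [mul_zero] at hs
    exact hpp.ne_zero (Nat.cast_eq_zero.1 hs.symm)
  · rw [zpow_zero, FractionalIdeal.spanSingleton_one]
  · rw [hsJ, zpow_natCast]
  · omega

theorem exists_isArakelovModular_one_of_mod_four_eq_three (hp : p % 4 = 3) :
    ∃ L : IdealLattice (RealCyclotomic (p ^ (k + 1))), L.α = 1 ∧ L.IsArakelovModular 1 := by
  have hp2 : p ≠ 2 := by rintro rfl; omega
  have hn : 1 < p ^ (k + 1) := one_lt_two.trans (two_lt_prime_pow hp2)
  obtain ⟨e, hD, he⟩ := coeIdeal_differentIdeal_eq_pow (k := k) hp2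
  obtain ⟨m, hm⟩ := even_of_two_mul_add_one_eq hp he
  refine IdealLattice.exists_isArakelovModular (a := 0) (b := 0) (m := -m)
    (ramifiedIdeal_ne_zero hn) hD one_ne_zero (fun σ => ?_)
    (one_ne_zero : (1 : RealCyclotomic (p ^ (k + 1))) ≠ 0) ?_ ?_ ?_ ?_
  · rw [map_one]
    exact one_pos
  · rw [zpow_zero, FractionalIdeal.spanSingleton_one]
  · rw [zpow_zero, FractionalIdeal.spanSingleton_one]
  · omega
  · simp

theorem coe_inv_two_sub_gen (n : ℕ) :
    (((2 - gen n)⁻¹ : RealCyclotomic n) : ℂ) =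
      (((2 - 2 * Real.cos (2 * Real.pi / n))⁻¹ : ℝ) : ℂ) := by
  rw [Complex.ofReal_inv, ← coe_two_sub_gen]
  rfl

end RealCyclotomic

end

theorem mainTheorem1 (p r : ℕ) [Fact p.Prime] (hp : p ≠ 2) (hr : 0 < r) :
    -- the classification
    (p ≡ 1 [MOD 4] → ∀ ℓ : ℕ, Squarefree ℓ →
      ((∃ L : IdealLattice (RealCyclotomic (p ^ r)), L.IsArakelovModular ℓ) ↔
        ℓ = 1 ∨ ℓ = p)) ∧
    (p ≡ 3 [MOD 4] → ∀ ℓ : ℕ, Squarefree ℓ →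
      ((∃ L : IdealLattice (RealCyclotomic (p ^ r)), L.IsArakelovModular ℓ) ↔ ℓ = 1)) ∧
    -- the twists that realize the levels
    (p ≡ 1 [MOD 4] → ∃ L : IdealLattice (RealCyclotomic (p ^ r)),
      (L.α : ℂ) = (((2 - 2 * Real.cos (2 * Real.pi / (p ^ r : ℕ)))⁻¹ : ℝ) : ℂ) ∧
        L.IsArakelovModular 1) ∧
    (p ≡ 1 [MOD 8] → ∃ L : IdealLattice (RealCyclotomic (p ^ r)),
      (L.α : ℂ) = (((2 - 2 * Real.cos (2 * Real.pi / (p ^ r : ℕ)))⁻¹ : ℝ) : ℂ) ∧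
        L.IsArakelovModular p) ∧
    (p ≡ 5 [MOD 8] → ∃ L : IdealLattice (RealCyclotomic (p ^ r)),
      L.α = 1 ∧ L.IsArakelovModular p) ∧
    (p ≡ 3 [MOD 4] → ∃ L : IdealLattice (RealCyclotomic (p ^ r)),
      L.α = 1 ∧ L.IsArakelovModular 1) := by
  obtain ⟨k, rfl⟩ := Nat.exists_eq_add_one.2 hr
  refine ⟨fun h l hl => ⟨?_, ?_⟩, fun h l hl => ⟨?_, ?_⟩, fun h => ?_, fun h => ?_, fun h => ?_,
    fun h => ?_⟩
  · rintro ⟨L, hL⟩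
    exact (RealCyclotomic.eq_one_or_eq_of_isArakelovModular hp hl hL).imp_right And.left
  · rintro (rfl | rfl)
    · obtain ⟨L, -, hL⟩ := RealCyclotomic.exists_isArakelovModular_one_of_mod_four_eq_one (k := k) h
      exact ⟨L, hL⟩
    · have h8 : l % 8 = 1 ∨ l % 8 = 5 := by
        unfold Nat.ModEq at h
        omega
      rcases h8 with h8 | h8
      · obtain ⟨L, -, hL⟩ :=
          RealCyclotomic.exists_isArakelovModular_prime_of_mod_eight_eq_one (k := k) h8
        exact ⟨L, hL⟩
      · obtain ⟨L, -, hL⟩ :=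
          RealCyclotomic.exists_isArakelovModular_prime_of_mod_eight_eq_five (k := k) h8
        exact ⟨L, hL⟩
  · rintro ⟨L, hL⟩
    refine (RealCyclotomic.eq_one_or_eq_of_isArakelovModular hp hl hL).resolve_right ?_
    rintro ⟨-, h1⟩
    unfold Nat.ModEq at h
    omega
  · rintro rfl
    obtain ⟨L, -, hL⟩ := RealCyclotomic.exists_isArakelovModular_one_of_mod_four_eq_three (k := k) h
    exact ⟨L, hL⟩
  · obtain ⟨L, hα, hL⟩ := RealCyclotomic.exists_isArakelovModular_one_of_mod_four_eq_one (k := k) h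
    exact ⟨L, by rw [hα, RealCyclotomic.coe_inv_two_sub_gen], hL⟩
  · obtain ⟨L, hα, hL⟩ :=
      RealCyclotomic.exists_isArakelovModular_prime_of_mod_eight_eq_one (k := k) h
    exact ⟨L, by rw [hα, RealCyclotomic.coe_inv_two_sub_gen], hL⟩
  · exact RealCyclotomic.exists_isArakelovModular_prime_of_mod_eight_eq_five h
  · exact RealCyclotomic.exists_isArakelovModular_one_of_mod_four_eq_three h
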